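/- Let $(E,d)$ be a complete separable metric space with its Borel $\sigma$-algebra, and let $(\Omega,\mathcal F,\mathbb P)$ be a probability space with a jointly measurable group $\theta=(\theta_t)_{t\in\mathbb R}$ of measure-preserving maps for which $\mathbb P$ is ergodic. Let $\varphi:\mathbb R_+\times\Omega\times E\to E$ be a white-noise random dynamical system over $\theta$. This means that $\varphi$ is measurable; that $x\mapsto\varphi_t(\omega,x)$ is continuous for all $t\ge 0$, $\omega\in\Omega$; that $\varphi_0(\omega,x)=x$ and $\varphi_{t+s}(\omega,x)=\varphi_t(\theta_s\omega,\varphi_s(\omega,x))$ for all $s,t\ge0$, $\omega\in\Omega$, $x\in E$; and that there is a family $(\mathcal F_{s,t})_{s\le t}$, indexed by real numbers $s\le t$, of sub-$\sigma$-algebras of $\mathcal F$ such that - $\mathcal F_{t,u}\subseteq\mathcal F_{s,v}$ for $s\le t\le u\le v$, - $\theta_r^{-1}(\mathcal F_{s,t})=\mathcal F_{s+r,t+r}$ for all $r\in\mathbb R$ and $s\le t$, - $\mathcal F_{t_0,t_1},\dots,\mathcal F_{t_{n-1},t_n}$ are independent for all $t_0\le\dots\le t_n$, - $\varphi_s(\cdot,x)$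 is $\mathcal F_{0,s}$-measurable for all $s\ge 0$, $x\in E$. Write $\mathcal F_0$ for the $\sigma$-algebra generated by all $\mathcal F_{s,0}$, $s\le 0$, and $P_tf(x)=\mathbb E f(\varphi_t(\cdot,x))$ for $f$ bounded and measurable. Let $\rho$ be a Borel probability measure on $E$ that is invariant, i.e. $\int P_tf\,d\rho=\int f\,d\rho$ for all $t\ge0$ and all bounded measurable $f$. Suppose that 1. (strong mixing) $\lim_{t\to\infty}P_tf(x)=\int f\,d\rho$ for every bounded continuous $f:E\to\mathbb R$ and every $x\in E$; 2. (weak global pointwise stability) there are a Borel set $U\subseteq E$ with $\rho(U)=1$ and a sequence $t_n\uparrow\infty$ in $\mathbb R_+$ such that for all $x,y\in U$ there is $\delta(x,y)>0$ such that for all $\eta>0$ $$\liminf_{n\to\infty}\mathbb P\big(d(\varphi_{t_n}(\cdot,x),\varphi_{t_n}(\cdot,y))\le\eta\big)\ge\delta(x,y).$$ Then weak synchronization holds: there is an $\mathcal F_0$-measurable random variable $a:\Omega\to E$ such that for every $t\ge0$, $\varphi_t(\omega,a(\omega))=a(\theta_t\omega)$ for $\mathbb P$-almost every $\omega$, and for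 every $x\in E$, $$\lim_{t\to\infty}d\big(\varphi_t(\theta_{-t}\omega,x),a(\omega)\big)=0\quad\text{in probability.}$$ -/

import Mathlib

open MeasureTheory ProbabilityTheory Filter Topology
open scoped NNReal ENNReal BoundedContinuousFunction

namespace RDS

/-- `(Ω, P, θ)` is an ergodic metric dynamical system: `θ` is a jointly measurable group of
`P`-preserving maps indexed by `ℝ`, and every strictly invariant event has probability
`0` or `1`. -/
structure IsErgodicMDS {Ω : Type*} [MeasurableSpace Ω] (P : Measure Ω) (θ : ℝ → Ω → Ω) :
    Prop where
  measurable_flow : Measurable (fun p : ℝ × Ω => θ p.1 p.2)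
  flow_zero : ∀ ω, θ 0 ω = ω
  flow_add : ∀ s t ω, θ (s + t) ω = θ s (θ t ω)
  measurePreserving : ∀ t, MeasurePreserving (θ t) P P
  ergodic : ∀ A : Set Ω, MeasurableSet A → (∀ t, θ t ⁻¹' A = A) → P A = 0 ∨ P A = 1

/-- `φ` is a random dynamical system over `(Ω, P, θ)` with state space `E`: a jointly measurable
perfect cocycle, continuous in the space variable. `φ t ω x` stands for `φ_t(ω, x)`. -/
structure IsRDS {Ω E : Type*} [MeasurableSpace Ω] [TopologicalSpace E] [MeasurableSpace E]
    (P : Measure Ω) (θ : ℝ → Ω → Ω) (φ : ℝ≥0 → Ω → E → E) : Prop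
    extends IsErgodicMDS P θ where
  measurable_cocycle : Measurable (fun p : ℝ≥0 × Ω × E => φ p.1 p.2.1 p.2.2)
  cocycle_zero : ∀ ω x, φ 0 ω x = x
  cocycle_add : ∀ (t s : ℝ≥0) (ω : Ω) (x : E), φ (t + s) ω x = φ t (θ s ω) (φ s ω x)
  continuous_space : ∀ t ω, Continuous (φ t ω)

/-- `φ` is a white noise (filtered) random dynamical system, with respect to the family of
σ-algebras `F s t`, of which only those with `s ≤ t` matter. -/
structure IsWhiteNoiseRDS {Ω E : Type*} [mΩ : MeasurableSpace Ω] [TopologicalSpace E]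
    [MeasurableSpace E] (P : Measure Ω) (θ : ℝ → Ω → Ω) (F : ℝ → ℝ → MeasurableSpace Ω)
    (φ : ℝ≥0 → Ω → E → E) : Prop
    extends IsRDS P θ φ where
  sub_sigma : ∀ s t, s ≤ t → F s t ≤ mΩ
  mono : ∀ s t u v, s ≤ t → t ≤ u → u ≤ v → F t u ≤ F s v
  shift : ∀ r s t, s ≤ t → MeasurableSpace.comap (θ r) (F s t) = F (s + r) (t + r)
  indep : ∀ (n : ℕ) (t : Fin (n + 1) → ℝ), Monotone t →
    iIndep (fun i : Fin n => F (t i.castSucc) (t i.succ)) P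
  adapted : ∀ (s : ℝ≥0) (x : E), Measurable[F 0 s] (fun ω => φ s ω x)

/-- The past σ-algebra `F_t`, generated by all `F s t` with `s ≤ t`. -/
abbrev past {Ω : Type*} (F : ℝ → ℝ → MeasurableSpace Ω) (t : ℝ) : MeasurableSpace Ω :=
  ⨆ (s : ℝ) (_ : s ≤ t), F s t

/-- The associated Markov semigroup, `P_t f(x) = 𝔼 f(φ_t(·, x))`. -/
noncomputable def semigroup {Ω E : Type*} [MeasurableSpace Ω] (P : Measure Ω)
    (φ : ℝ≥0 → Ω → E → E) (t : ℝ≥0) (f : E → ℝ) (x : E) : ℝ :=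
  ∫ ω, f (φ t ω x) ∂P

/-- `ρ` is invariant for the Markov semigroup: `∫ P_t f dρ = ∫ f dρ` for all bounded
measurable `f`. -/
def IsInvariant {Ω E : Type*} [MeasurableSpace Ω] [MeasurableSpace E] (P : Measure Ω)
    (φ : ℝ≥0 → Ω → E → E) (ρ : Measure E) : Prop :=
  ∀ (t : ℝ≥0) (f : E → ℝ), Measurable f → (∃ C : ℝ, ∀ x, |f x| ≤ C) →
    ∫ x, semigroup P φ t f x ∂ρ = ∫ x, f x ∂ρ

/-- Strong mixing: `P_t f(x) → ∫ f dρ` as `t → ∞` for every bounded continuous `f` and every `x`,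
that is, the law of `φ_t(·, x)` converges weakly to `ρ` for every `x`. -/
def IsStronglyMixing {Ω E : Type*} [MeasurableSpace Ω] [TopologicalSpace E] [MeasurableSpace E]
    (P : Measure Ω) (φ : ℝ≥0 → Ω → E → E) (ρ : Measure E) : Prop :=
  ∀ (f : E →ᵇ ℝ) (x : E), Tendsto (fun t : ℝ≥0 => semigroup P φ t f x) atTop (𝓝 (∫ y, f y ∂ρ))

/-- Weak global pointwise stability. The constant `δ` may depend on the two points, but not
on `η`. -/
def WeakGlobalPointwiseStability {Ω E : Type*} [MeasurableSpace Ω] [MetricSpace E]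
    [MeasurableSpace E] (P : Measure Ω) (φ : ℝ≥0 → Ω → E → E) (ρ : Measure E) : Prop :=
  ∃ (U : Set E) (t : ℕ → ℝ≥0), MeasurableSet U ∧ ρ U = 1 ∧ Monotone t ∧ Tendsto t atTop atTop ∧
    ∀ x ∈ U, ∀ y ∈ U, ∃ δ : ℝ≥0∞, 0 < δ ∧ ∀ η : ℝ, 0 < η →
      δ ≤ liminf (fun n : ℕ => P {ω | dist (φ (t n) ω x) (φ (t n) ω y) ≤ η}) atTop

/-- Weak synchronization: there is a random point, measurable with respect to the past `F_0`,
which is invariant under the cocycle and attracts every deterministic point in probability in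
the pullback sense. -/
def WeakSynchronization {Ω E : Type*} [MeasurableSpace Ω] [MetricSpace E] [MeasurableSpace E]
    (P : Measure Ω) (θ : ℝ → Ω → Ω) (F : ℝ → ℝ → MeasurableSpace Ω)
    (φ : ℝ≥0 → Ω → E → E) : Prop :=
  ∃ a : Ω → E, Measurable[past F 0] a ∧
    (∀ t : ℝ≥0, ∀ᵐ ω ∂P, φ t ω (a ω) = a (θ t ω)) ∧
    ∀ x : E, TendstoInMeasure P (fun (t : ℝ≥0) ω => dist (φ t (θ (-(t : ℝ)) ω) x) (a ω)) atTop
      (fun _ => (0 : ℝ))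

end RDS

/-! Let two particles, started independently from `ρ`, be driven by the same noise. For bounded
continuous `f`, the integral of `f ⊗ f` against their joint law at time `t` is `𝔼 (∫ f(φ_t(·, x))
dρ)²`. By Jensen and invariance of `ρ` it is nondecreasing in `t`, so it converges; polarization
gives convergence for all `f ⊗ g`. Both marginals stay equal to `ρ`, so the joint laws are tight.
Any limit point `Q` is invariant for the two-point motion, since products `f ⊗ g` determine a
measure (`exists_limit_twoPoint`).

Invariance makes the mass that `Q` gives to a neighbourhood of the diagonal constant in time, while
stability feeds at least `δ` into every neighbourhood from each off-diagonal pair in `U × U`.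
Shrinking the neighbourhood and applying Fatou forces `Q` onto the diagonal
(`ae_eq_of_twoPoint_eq`). Hence at some time `r` the two particles are close on average.

Strong mixing replaces one `ρ`-distributed start by `φ_s(·, x)` with `s` large. Thus pullback
motions at late times, from any two points, are close to a common pullback at time `r`, hence to
each other (`exists_lintegral_truncEDist_pullback_le`). A rapidly Cauchy sequence of times defines
`a`; Fatou extends convergence to all times and starting points, and the cocycle property gives
invariance. -/

namespace RDS

/-! ### The two-point motion and its Markov property -/

/-- The law of `(φ_t(ω, x), φ_t(ω, y))` when `(x, y)` has law `μ` and is independent of `ω`. -/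
noncomputable def twoPoint {Ω E : Type*} [MeasurableSpace Ω] [MeasurableSpace E] (P : Measure Ω)
    (φ : ℝ≥0 → Ω → E → E) (t : ℝ≥0) (μ : Measure (E × E)) : Measure (E × E) :=
  (μ.prod P).map (fun p => (φ t p.2 p.1.1, φ t p.2 p.1.2))

section Measurability

variable {Ω E : Type*} [MeasurableSpace Ω] [TopologicalSpace E] [MeasurableSpace E]
  {P : Measure Ω} {θ : ℝ → Ω → Ω} {φ : ℝ≥0 → Ω → E → E}

theorem IsRDS.measurable_comp (hφ : IsRDS P θ φ) (t : ℝ≥0) {α : Type*} [MeasurableSpace α]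
    {w : α → Ω} {u : α → E} (hw : Measurable w) (hu : Measurable u) :
    Measurable fun a => φ t (w a) (u a) :=
  hφ.measurable_cocycle.comp (measurable_const.prodMk (hw.prodMk hu))

theorem IsRDS.measurable_flow_apply (hφ : IsRDS P θ φ) (t : ℝ) : Measurable (θ t) :=
  (hφ.measurePreserving t).measurable

theorem IsRDS.measurable_pair (hφ : IsRDS P θ φ) (t : ℝ≥0) :
    Measurable fun p : (E × E) × Ω => (φ t p.2 p.1.1, φ t p.2 p.1.2) :=
  (hφ.measurable_comp t (by fun_prop) (by fun_prop)).prodMk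
    (hφ.measurable_comp t (by fun_prop) (by fun_prop))

theorem IsRDS.lintegral_twoPoint [SFinite P] (hφ : IsRDS P θ φ) (t : ℝ≥0) (μ : Measure (E × E))
    {h : E × E → ℝ≥0∞} (hh : Measurable h) :
    ∫⁻ q, h q ∂(twoPoint P φ t μ) = ∫⁻ q, ∫⁻ ω, h (φ t ω q.1, φ t ω q.2) ∂P ∂μ := by
  rw [twoPoint, lintegral_map hh (hφ.measurable_pair t)]
  exact lintegral_prod _ (hh.comp (hφ.measurable_pair t)).aemeasurable

theorem IsRDS.isProbabilityMeasure_twoPoint [IsProbabilityMeasure P] (hφ : IsRDS P θ φ) (t : ℝ≥0)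
    (μ : Measure (E × E)) [IsProbabilityMeasure μ] : IsProbabilityMeasure (twoPoint P φ t μ) :=
  Measure.isProbabilityMeasure_map (hφ.measurable_pair t).aemeasurable

theorem IsWhiteNoiseRDS.indep_consecutive {F : ℝ → ℝ → MeasurableSpace Ω}
    (hφ : IsWhiteNoiseRDS P θ F φ) {r s t : ℝ} (hrs : r ≤ s) (hst : s ≤ t) : Indep (F r s) (F s t) P := by
  have h := hφ.indep 2 ![r, s, t] (by
    intro i j hij
    fin_cases i <;> fin_cases j <;> simp_all [hrs.trans hst])
  simpa using h.indep (i := 0) (j := 1) (by decide)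

end Measurability

section Independence

variable {Ω E : Type*} [mΩ : MeasurableSpace Ω] [MetricSpace E] [SecondCountableTopology E]
  [MeasurableSpace E] [BorelSpace E]
  {P : Measure Ω} [IsProbabilityMeasure P] {θ : ℝ → Ω → Ω} {F : ℝ → ℝ → MeasurableSpace Ω}
  {φ : ℝ≥0 → Ω → E → E}

theorem lintegral_comp_prodMk_of_indep {Ω' A B : Type*} [MeasurableSpace Ω']
    [MeasurableSpace A] [MeasurableSpace B] {P : Measure Ω'} [IsProbabilityMeasure P] {X : Ω' → A}
    {Y : Ω' → B} (hX : Measurable X) (hY : Measurable Y) (h : Indep (MeasurableSpace.comap X inferInstance) (MeasurableSpace.comap Y inferInstance) P)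
    {H : A × B → ℝ≥0∞} (hH : Measurable H) :
    ∫⁻ ω, H (X ω, Y ω) ∂P = ∫⁻ ω₁, ∫⁻ ω₂, H (X ω₁, Y ω₂) ∂P ∂P := by
  have e := (indepFun_iff_map_prod_eq_prod_map_map hX.aemeasurable hY.aemeasurable).1
    ((IndepFun_iff_Indep X Y P).2 h)
  have : IsProbabilityMeasure (P.map X) := Measure.isProbabilityMeasure_map hX.aemeasurable
  have : IsProbabilityMeasure (P.map Y) := Measure.isProbabilityMeasure_map hY.aemeasurable
  rw [← lintegral_map hH (hX.prodMk hY), e, lintegral_prod _ hH.aemeasurable,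
    lintegral_map hH.lintegral_prod_right' hX]
  refine lintegral_congr fun ω => ?_
  exact lintegral_map (hH.comp measurable_prodMk_left) hY

/-- Markov property: the noise after time `s` is independent of `F 0 s` and, by stationarity, may be
replaced by a fresh copy. -/
theorem IsWhiteNoiseRDS.lintegral_pair_comp_flow (hφ : IsWhiteNoiseRDS P θ F φ) (s t : ℝ≥0)
    {u v : Ω → E} (hu : Measurable[F 0 s] u) (hv : Measurable[F 0 s] v)
    {h : E × E → ℝ≥0∞} (hh : Measurable h) :
    ∫⁻ ω, h (φ t (θ s ω) (u ω), φ t (θ s ω) (v ω)) ∂P =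
      ∫⁻ ω₁, ∫⁻ ω₂, h (φ t ω₂ (u ω₁), φ t ω₂ (v ω₁)) ∂P ∂P := by
  have hle : F 0 s ≤ mΩ := hφ.sub_sigma _ _ s.2
  have hle' : F 0 t ≤ mΩ := hφ.sub_sigma _ _ t.2
  have hshift : MeasurableSpace.comap (θ s) (F 0 t) = F s (s + t) := by
    rw [hφ.shift s 0 t t.2, zero_add, add_comm]
  have hind : Indep (MeasurableSpace.comap (fun ω => (u ω, v ω)) inferInstance)
      (MeasurableSpace.comap (θ s) (F 0 t)) P := by
    refine indep_of_indep_of_le (hφ.indep_consecutive s.2 (t := s + t) (by simp)) ?_ hshift.le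
    exact (hu.prodMk hv).comap_le
  -- Independence only concerns `F 0 t`, so joint measurability with respect to the full σ-algebra
  -- is not enough. Continuity in space upgrades adaptedness at each point to joint measurability
  -- over `F 0 t`.
  have hunc : @Measurable (E × Ω) E (@Prod.instMeasurableSpace _ _ _ (F 0 t)) _
      (Function.uncurry fun x ω => φ t ω x) :=
    @measurable_uncurry_of_continuous_of_measurable Ω E E _ _ _ _ _ _ _ _ _ (F 0 t)
      (fun x ω => φ t ω x) (fun ω => hφ.continuous_space t ω) (fun x => hφ.adapted t x)
  have hH : @Measurable ((E × E) × Ω) ℝ≥0∞ (@Prod.instMeasurableSpace _ _ _ (F 0 t)) _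
      (fun p => h (φ t p.2 p.1.1, φ t p.2 p.1.2)) := by
    let := F 0 t
    exact hh.comp ((hunc.comp (measurable_fst.fst.prodMk measurable_snd)).prodMk
      (hunc.comp (measurable_fst.snd.prodMk measurable_snd)))
  have key := @lintegral_comp_prodMk_of_indep Ω (E × E) Ω mΩ _ (F 0 t) P _
    (fun ω => (u ω, v ω)) (θ s) ((hu.mono hle le_rfl).prodMk (hv.mono hle le_rfl))
    ((hφ.measurable_flow_apply s).mono le_rfl hle') hind _ hH
  rw [key]
  refine lintegral_congr fun ω₁ => ?_
  exact (hφ.measurePreserving s).lintegral_comp (f := fun ω₂ => h (φ t ω₂ (u ω₁), φ t ω₂ (v ω₁)))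
    (hh.comp ((hφ.measurable_comp t measurable_id measurable_const).prodMk
      (hφ.measurable_comp t measurable_id measurable_const)))

theorem IsWhiteNoiseRDS.twoPoint_add (hφ : IsWhiteNoiseRDS P θ F φ) (t s : ℝ≥0)
    (μ : Measure (E × E)) : twoPoint P φ (t + s) μ = twoPoint P φ t (twoPoint P φ s μ) := by
  refine Measure.ext_of_lintegral _ fun h hh => ?_
  have hH : Measurable fun q : E × E => ∫⁻ ω, h (φ t ω q.1, φ t ω q.2) ∂P :=
    (hh.comp (hφ.measurable_pair t)).lintegral_prod_right'
  rw [hφ.lintegral_twoPoint _ _ hh, hφ.lintegral_twoPoint _ _ hh, hφ.lintegral_twoPoint _ _ hH]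
  refine lintegral_congr fun q => ?_
  simp_rw [hφ.cocycle_add]
  exact hφ.lintegral_pair_comp_flow s t (hφ.adapted s q.1) (hφ.adapted s q.2) hh

end Independence

end RDS

/-! ### Marginals and monotone second moments -/

namespace RDS

/-- The function `(x, y) ↦ f x * g y`. -/
noncomputable def tensor {E : Type*} [TopologicalSpace E] (f g : E →ᵇ ℝ) : E × E →ᵇ ℝ :=
  f.compContinuous ⟨Prod.fst, continuous_fst⟩ * g.compContinuous ⟨Prod.snd, continuous_snd⟩

theorem tensor_apply {E : Type*} [TopologicalSpace E] (f g : E →ᵇ ℝ) (q : E × E) : tensor f g q = f q.1 * g q.2 := rfl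

theorem sq_integral_le_integral_sq {Ω : Type*} [MeasurableSpace Ω] {P : Measure Ω} [IsProbabilityMeasure P]
    {X : Ω → ℝ} (hX : MemLp X 2 P) : (∫ ω, X ω ∂P) ^ 2 ≤ ∫ ω, X ω ^ 2 ∂P := by
  have h := variance_nonneg X P
  rw [variance_eq_sub hX] at h
  simpa using h

section Marginals

variable {Ω E : Type*} [MeasurableSpace Ω] [TopologicalSpace E] [MeasurableSpace E]
  {P : Measure Ω} [IsProbabilityMeasure P] {θ : ℝ → Ω → Ω} {φ : ℝ≥0 → Ω → E → E}
  {ρ : Measure E} [IsProbabilityMeasure ρ]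

theorem IsInvariant.map_prod_eq (hφ : IsRDS P θ φ) (hinv : IsInvariant P φ ρ) (t : ℝ≥0) :
    (ρ.prod P).map (fun p => φ t p.2 p.1) = ρ := by
  have hm : Measurable fun p : E × Ω => φ t p.2 p.1 :=
    hφ.measurable_comp t measurable_snd measurable_fst
  have : IsProbabilityMeasure ((ρ.prod P).map fun p => φ t p.2 p.1) :=
    Measure.isProbabilityMeasure_map hm.aemeasurable
  ext A hA
  have hfm : Measurable (A.indicator (fun _ => (1 : ℝ))) := measurable_const.indicator hA
  have hb : ∀ x, |A.indicator (fun _ => (1 : ℝ)) x| ≤ 1 := fun x => by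
    by_cases hx : x ∈ A <;> simp [hx]
  have h := hinv t (A.indicator fun _ => 1) hfm ⟨1, hb⟩
  have hi : Integrable (fun p : E × Ω => A.indicator (fun _ => (1 : ℝ)) (φ t p.2 p.1))
      (ρ.prod P) :=
    Integrable.of_bound (hfm.comp hm).aestronglyMeasurable 1 (ae_of_all _ fun p => hb _)
  simp only [semigroup] at h
  rw [← integral_prod _ hi, ← integral_map hm.aemeasurable hfm.aestronglyMeasurable,
    integral_indicator hA, integral_indicator hA] at h
  simp only [integral_const, MeasurableSet.univ, measureReal_restrict_apply, Set.univ_inter,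
    smul_eq_mul, mul_one] at h
  exact (measureReal_eq_measureReal_iff).1 h

theorem IsInvariant.map_fst_twoPoint (hφ : IsRDS P θ φ) (hinv : IsInvariant P φ ρ) (t : ℝ≥0)
    {μ : Measure (E × E)} [SFinite μ] (hμ : μ.map Prod.fst = ρ) :
    (twoPoint P φ t μ).map Prod.fst = ρ := by
  have hm : Measurable fun p : E × Ω => φ t p.2 p.1 :=
    hφ.measurable_comp t measurable_snd measurable_fst
  have h : (μ.prod P).map (Prod.map Prod.fst id) = ρ.prod P := by
    rw [← Measure.map_prod_map _ _ measurable_fst measurable_id, hμ, Measure.map_id]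
  rw [twoPoint, Measure.map_map measurable_fst (hφ.measurable_pair t)]
  conv_rhs => rw [← hinv.map_prod_eq hφ t, ← h, Measure.map_map hm (by fun_prop)]
  rfl

theorem IsInvariant.map_snd_twoPoint (hφ : IsRDS P θ φ) (hinv : IsInvariant P φ ρ) (t : ℝ≥0)
    {μ : Measure (E × E)} [SFinite μ] (hμ : μ.map Prod.snd = ρ) :
    (twoPoint P φ t μ).map Prod.snd = ρ := by
  have hm : Measurable fun p : E × Ω => φ t p.2 p.1 :=
    hφ.measurable_comp t measurable_snd measurable_fst
  have h : (μ.prod P).map (Prod.map Prod.snd id) = ρ.prod P := by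
    rw [← Measure.map_prod_map _ _ measurable_snd measurable_id, hμ, Measure.map_id]
  rw [twoPoint, Measure.map_map measurable_snd (hφ.measurable_pair t)]
  conv_rhs => rw [← hinv.map_prod_eq hφ t, ← h, Measure.map_map hm (by fun_prop)]
  rfl

end Marginals

section Feller

variable {Ω E : Type*} [MeasurableSpace Ω] [MetricSpace E] [SecondCountableTopology E]
  [MeasurableSpace E] [BorelSpace E]
  {P : Measure Ω} [IsProbabilityMeasure P] {θ : ℝ → Ω → Ω} {F : ℝ → ℝ → MeasurableSpace Ω}
  {φ : ℝ≥0 → Ω → E → E} {ρ : Measure E} [IsProbabilityMeasure ρ]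

/-- The semigroup of the two-point motion acting on bounded continuous functions. -/
noncomputable def twoPointFeller (hφ : IsRDS P θ φ) (t : ℝ≥0) (f : E × E →ᵇ ℝ) : E × E →ᵇ ℝ :=
  BoundedContinuousFunction.ofNormedAddCommGroup
    (fun q => ∫ ω, f (φ t ω q.1, φ t ω q.2) ∂P)
    (continuous_of_dominated (bound := fun _ => ‖f‖)
      (fun q => (f.continuous.measurable.comp
        ((hφ.measurable_comp t measurable_id measurable_const).prodMk
          (hφ.measurable_comp t measurable_id measurable_const))).aestronglyMeasurable)
      (fun q => ae_of_all _ fun ω => f.norm_coe_le_norm _) (integrable_const _)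
      (ae_of_all _ fun ω => f.continuous.comp
        (((hφ.continuous_space t ω).comp continuous_fst).prodMk
          ((hφ.continuous_space t ω).comp continuous_snd))))
    ‖f‖ (fun q => by
      refine (norm_integral_le_of_norm_le_const (ae_of_all _ fun ω => f.norm_coe_le_norm _)).trans ?_
      simp)

theorem twoPointFeller_apply (hφ : IsRDS P θ φ) (t : ℝ≥0) (f : E × E →ᵇ ℝ) (q : E × E) :
    twoPointFeller hφ t f q = ∫ ω, f (φ t ω q.1, φ t ω q.2) ∂P := rfl

theorem IsRDS.integrable_pair (hφ : IsRDS P θ φ) (t : ℝ≥0) (μ : Measure (E × E))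
    [IsFiniteMeasure μ] (f : E × E →ᵇ ℝ) :
    Integrable (fun p : (E × E) × Ω => f (φ t p.2 p.1.1, φ t p.2 p.1.2)) (μ.prod P) :=
  Integrable.of_bound
    (f.continuous.measurable.comp (hφ.measurable_pair t)).aestronglyMeasurable ‖f‖
    (ae_of_all _ fun _ => f.norm_coe_le_norm _)

theorem IsRDS.integral_twoPoint_eq_prod {P : Measure Ω} (hφ : IsRDS P θ φ) (t : ℝ≥0)
    (μ : Measure (E × E))
    (f : E × E →ᵇ ℝ) : ∫ q, f q ∂(twoPoint P φ t μ) =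
      ∫ p, f (φ t p.2 p.1.1, φ t p.2 p.1.2) ∂(μ.prod P) :=
  integral_map (hφ.measurable_pair t).aemeasurable f.continuous.measurable.aestronglyMeasurable

theorem IsRDS.integral_twoPoint (hφ : IsRDS P θ φ) (t : ℝ≥0) (μ : Measure (E × E))
    [IsFiniteMeasure μ] (f : E × E →ᵇ ℝ) :
    ∫ q, f q ∂(twoPoint P φ t μ) = ∫ q, twoPointFeller hφ t f q ∂μ := by
  rw [hφ.integral_twoPoint_eq_prod, integral_prod _ (hφ.integrable_pair t μ f)]
  rfl

theorem IsRDS.integral_twoPoint_symm (hφ : IsRDS P θ φ) (t : ℝ≥0) (μ : Measure (E × E))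
    [IsFiniteMeasure μ] (f : E × E →ᵇ ℝ) :
    ∫ q, f q ∂(twoPoint P φ t μ) = ∫ ω, ∫ q, f (φ t ω q.1, φ t ω q.2) ∂μ ∂P := by
  rw [hφ.integral_twoPoint_eq_prod, integral_prod_symm _ (hφ.integrable_pair t μ f)]

/-- For frozen noise the two particles are independent, so the inner integral factorizes. -/
theorem IsRDS.integral_tensor (hφ : IsRDS P θ φ) (t : ℝ≥0) (f g : E →ᵇ ℝ) :
    ∫ q, tensor f g q ∂(twoPoint P φ t (ρ.prod ρ)) =
      ∫ ω, (∫ x, f (φ t ω x) ∂ρ) * ∫ x, g (φ t ω x) ∂ρ ∂P := by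
  rw [hφ.integral_twoPoint_symm]
  refine integral_congr_ae (ae_of_all _ fun ω => ?_)
  exact integral_prod_mul (fun x => f (φ t ω x)) (fun x => g (φ t ω x))

/-- Jensen for the random variable `∫ f(φ_t(·, x)) dρ`, whose mean is `∫ f dρ` by invariance. -/
theorem IsInvariant.sq_integral_le_integral_tensor (hφ : IsRDS P θ φ) (hinv : IsInvariant P φ ρ)
    (t : ℝ≥0) (f : E →ᵇ ℝ) :
    (∫ x, f x ∂ρ) ^ 2 ≤ ∫ q, tensor f f q ∂(twoPoint P φ t (ρ.prod ρ)) := by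
  have hm : Measurable fun p : E × Ω => φ t p.2 p.1 :=
    hφ.measurable_comp t measurable_snd measurable_fst
  have hi : Integrable (fun p : E × Ω => f (φ t p.2 p.1)) (ρ.prod P) :=
    Integrable.of_bound (f.continuous.measurable.comp hm).aestronglyMeasurable ‖f‖
      (ae_of_all _ fun _ => f.norm_coe_le_norm _)
  have h : ∫ x, f x ∂ρ = ∫ ω, ∫ x, f (φ t ω x) ∂ρ ∂P := by
    conv_lhs => rw [← hinv.map_prod_eq hφ t]
    rw [integral_map hm.aemeasurable f.continuous.measurable.aestronglyMeasurable,
      integral_prod_symm _ hi]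
  rw [h, hφ.integral_tensor]
  simp_rw [← sq]
  refine sq_integral_le_integral_sq ?_
  refine MemLp.of_bound hi.integral_prod_right.aestronglyMeasurable ‖f‖ (ae_of_all _ fun ω => ?_)
  refine (norm_integral_le_of_norm_le_const (ae_of_all _ fun ω => f.norm_coe_le_norm _)).trans ?_
  simp

theorem IsInvariant.monotone_integral_tensor (hφ : IsWhiteNoiseRDS P θ F φ)
    (hinv : IsInvariant P φ ρ) (f : E →ᵇ ℝ) :
    Monotone fun t => ∫ q, tensor f f q ∂(twoPoint P φ t (ρ.prod ρ)) := by
  intro t t' htt'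
  obtain ⟨s, rfl⟩ := exists_add_of_le htt'
  have := hφ.isProbabilityMeasure_twoPoint s (ρ.prod ρ)
  simp only
  rw [hφ.twoPoint_add, hφ.integral_tensor, hφ.integral_twoPoint_symm]
  refine integral_mono ?_ (hφ.integrable_pair t _ (tensor f f)).integral_prod_right fun ω => ?_
  · refine (hφ.integrable_pair t (ρ.prod ρ) (tensor f f)).integral_prod_right.congr
      (ae_of_all _ fun ω => ?_)
    exact integral_prod_mul (fun x => f (φ t ω x)) (fun x => f (φ t ω x))
  -- Freeze the later noise `ω`, acting over duration `t`, and apply the Jensen bound for the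
  -- earlier duration `s` to `f ∘ φ_t(ω, ·)`.
  · have h := hinv.sq_integral_le_integral_tensor hφ.toIsRDS s
      (f.compContinuous ⟨φ t ω, hφ.continuous_space t ω⟩)
    rw [sq] at h
    exact h

/-- Monotone and bounded when `f = g`; the general case follows by polarization, the integral being
symmetric in `f` and `g`. -/
theorem IsInvariant.exists_tendsto_integral_tensor (hφ : IsWhiteNoiseRDS P θ F φ)
    (hinv : IsInvariant P φ ρ) (f g : E →ᵇ ℝ) :
    ∃ L, Tendsto (fun t => ∫ q, tensor f g q ∂(twoPoint P φ t (ρ.prod ρ))) atTop (𝓝 L) := by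
  have hpm := fun t => hφ.isProbabilityMeasure_twoPoint t (ρ.prod ρ)
  have hsq (f : E →ᵇ ℝ) :
      ∃ L, Tendsto (fun t => ∫ q, tensor f f q ∂(twoPoint P φ t (ρ.prod ρ))) atTop (𝓝 L) := by
    refine ⟨_, tendsto_atTop_ciSup (hinv.monotone_integral_tensor hφ f) ⟨‖tensor f f‖, ?_⟩⟩
    rintro _ ⟨t, rfl⟩
    refine (Real.le_norm_self _).trans ((norm_integral_le_of_norm_le_const
      (ae_of_all _ fun q => (tensor f f).norm_coe_le_norm q)).trans ?_)
    simp
  obtain ⟨a, ha⟩ := hsq (f + g)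
  obtain ⟨b, hb⟩ := hsq f
  obtain ⟨c, hc⟩ := hsq g
  refine ⟨(a - b - c) / 2, (((ha.sub hb).sub hc).div_const 2).congr fun t => ?_⟩
  have hcomm : ∫ q, tensor g f q ∂(twoPoint P φ t (ρ.prod ρ)) =
      ∫ q, tensor f g q ∂(twoPoint P φ t (ρ.prod ρ)) := by
    simp_rw [hφ.integral_tensor, mul_comm]
  have hexp : ∫ q, tensor (f + g) (f + g) q ∂(twoPoint P φ t (ρ.prod ρ)) =
      ∫ q, (tensor f f q + tensor f g q + (tensor g f q + tensor g g q))
        ∂(twoPoint P φ t (ρ.prod ρ)) := by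
    refine integral_congr_ae (ae_of_all _ fun q => ?_)
    simp only [tensor_apply, BoundedContinuousFunction.coe_add, Pi.add_apply]
    ring
  have hint (f g : E →ᵇ ℝ) : Integrable (tensor f g) (twoPoint P φ t (ρ.prod ρ)) :=
    (tensor f g).integrable _
  have hadd (f₁ g₁ f₂ g₂ : E →ᵇ ℝ) : Integrable (fun q => tensor f₁ g₁ q + tensor f₂ g₂ q)
      (twoPoint P φ t (ρ.prod ρ)) := (hint f₁ g₁).add (hint f₂ g₂)
  rw [hexp, integral_add (hadd f f f g) (hadd g f g g),
    integral_add (hint f f) (hint f g), integral_add (hint g f) (hint g g), hcomm]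
  ring

end Feller

end RDS

/-! ### An invariant limit law, concentrated on the diagonal -/

namespace RDS

section Limit

variable {Ω E : Type*} [MeasurableSpace Ω] [MetricSpace E] [SecondCountableTopology E]
  [MeasurableSpace E] [BorelSpace E]
  {P : Measure Ω} [IsProbabilityMeasure P] {θ : ℝ → Ω → Ω} {F : ℝ → ℝ → MeasurableSpace Ω}
  {φ : ℝ≥0 → Ω → E → E} {ρ : Measure E} [IsProbabilityMeasure ρ]

theorem IsInvariant.exists_limit_twoPoint [CompleteSpace E] (hφ : IsWhiteNoiseRDS P θ F φ)
    (hinv : IsInvariant P φ ρ) :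
    ∃ Q : Measure (E × E), IsProbabilityMeasure Q ∧
      Q.map Prod.fst = ρ ∧ Q.map Prod.snd = ρ ∧ (∀ t, twoPoint P φ t Q = Q) ∧
      ∃ (l : Filter ℕ), l.NeBot ∧ ∀ f : E × E →ᵇ ℝ,
        Tendsto (fun n : ℕ => ∫ q, f q ∂(twoPoint P φ n (ρ.prod ρ))) l (𝓝 (∫ q, f q ∂Q)) := by
  have hpm := fun t => hφ.isProbabilityMeasure_twoPoint t (ρ.prod ρ)
  have hfst (t : ℝ≥0) : (twoPoint P φ t (ρ.prod ρ)).map Prod.fst = ρ :=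
    hinv.map_fst_twoPoint hφ.toIsRDS t (by simp [Measure.map_fst_prod])
  have hsnd (t : ℝ≥0) : (twoPoint P φ t (ρ.prod ρ)).map Prod.snd = ρ :=
    hinv.map_snd_twoPoint hφ.toIsRDS t (by simp [Measure.map_snd_prod])
  let μ : ℕ → ProbabilityMeasure (E × E) := fun n => ⟨twoPoint P φ n (ρ.prod ρ), hpm n⟩
  have htight : IsTightMeasureSet {((ν : ProbabilityMeasure (E × E)) : Measure (E × E)) |
      ν ∈ Set.range μ} := by
    have hρ : IsTightMeasureSet ({ρ} : Set (Measure E)) := isTightMeasureSet_singleton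
    refine IsTightMeasureSet.prodMk (hρ.subset ?_) (hρ.subset ?_)
    · rintro _ ⟨_, ⟨_, ⟨n, rfl⟩, rfl⟩, rfl⟩
      exact hfst n
    · rintro _ ⟨_, ⟨_, ⟨n, rfl⟩, rfl⟩, rfl⟩
      exact hsnd n
  have hK := isCompact_closure_of_isTightMeasureSet htight
  -- A free ultrafilter finer than `atTop` makes the relatively compact sequence converge without
  -- extracting a subsequence.
  let l : Ultrafilter ℕ := hyperfilter ℕ
  have hl : (l : Filter ℕ) ≤ atTop := Nat.hyperfilter_le_atTop
  obtain ⟨Q, -, hQ⟩ := hK.ultrafilter_le_nhds' (l.map μ)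
    (by rw [Ultrafilter.mem_map]; exact univ_mem' fun n => subset_closure ⟨n, rfl⟩)
  have hQ' : Tendsto μ l (𝓝 Q) := hQ
  have hlim : ∀ f : E × E →ᵇ ℝ, Tendsto (fun n : ℕ => ∫ q, f q ∂(twoPoint P φ n (ρ.prod ρ))) l
      (𝓝 (∫ q, f q ∂(Q : Measure (E × E)))) :=
    ProbabilityMeasure.tendsto_iff_forall_integral_tendsto.1 hQ'
  have hmarg {π : E × E → E} (hπ : Continuous π)
      (h : ∀ t, (twoPoint P φ t (ρ.prod ρ)).map π = ρ) :
      (Q : Measure (E × E)).map π = ρ := by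
    have : IsProbabilityMeasure ((Q : Measure (E × E)).map π) :=
      Measure.isProbabilityMeasure_map hπ.measurable.aemeasurable
    refine ext_of_forall_integral_eq_of_IsFiniteMeasure fun f => ?_
    rw [integral_map hπ.measurable.aemeasurable f.continuous.measurable.aestronglyMeasurable]
    refine tendsto_nhds_unique (hlim (f.compContinuous ⟨π, hπ⟩)) ?_
    refine tendsto_const_nhds.congr fun n => ?_
    conv_lhs => rw [← h n,
      integral_map hπ.measurable.aemeasurable f.continuous.measurable.aestronglyMeasurable]
    rfl
  refine ⟨Q, inferInstance, hmarg continuous_fst hfst, hmarg continuous_snd hsnd, fun t => ?_,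
    l, inferInstance, hlim⟩
  have := hφ.isProbabilityMeasure_twoPoint t (Q : Measure (E × E))
  refine Measure.ext_of_integral_mul_boundedContinuousFunction fun f g => ?_
  change ∫ q, tensor f g q ∂(twoPoint P φ t Q) = ∫ q, tensor f g q ∂(Q : Measure (E × E))
  obtain ⟨L, hL⟩ := hinv.exists_tendsto_integral_tensor hφ f g
  have hn : Tendsto (fun n : ℕ => (n : ℝ≥0)) l atTop := tendsto_natCast_atTop_atTop.mono_left hl
  -- Tensor integrals have a limit `L` over all times, so advancing time from `n` to `t + n` does
  -- not change it; the Feller property moves the advance onto the test function.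
  rw [tendsto_nhds_unique (hlim (tensor f g)) (hL.comp hn), hφ.integral_twoPoint]
  refine tendsto_nhds_unique (hlim (twoPointFeller hφ.toIsRDS t (tensor f g))) ?_
  refine (hL.comp (tendsto_atTop_mono (fun n : ℕ => (le_add_self : (n : ℝ≥0) ≤ t + n)) hn)).congr fun n => ?_
  rw [Function.comp_apply, hφ.twoPoint_add, hφ.integral_twoPoint]

/-- The diagonal is absorbing, so in the invariance identity for `Q (B k)` it accounts for exactly
`Q D`. The inflow from off the diagonal is then `Q (B k \ D)`, which vanishes as `k → ∞`, whereas
stability bounds its density below by `δ`. -/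
theorem WeakGlobalPointwiseStability.ae_eq_of_twoPoint_eq (hφ : IsRDS P θ φ)
    (hstab : WeakGlobalPointwiseStability P φ ρ) {Q : Measure (E × E)} [IsProbabilityMeasure Q]
    (hfst : Q.map Prod.fst = ρ) (hsnd : Q.map Prod.snd = ρ)
    (hQ : ∀ t, twoPoint P φ t Q = Q) : ∀ᵐ q ∂Q, q.1 = q.2 := by
  obtain ⟨U, t, hU, hρU, -, -, hδ⟩ := hstab
  have hρ : ∀ᵐ x ∂ρ, x ∈ U := (prob_compl_eq_zero_iff hU).2 hρU
  have h₁ : ∀ᵐ q ∂Q, q.1 ∈ U := by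
    rw [← hfst] at hρ
    exact ae_of_ae_map measurable_fst.aemeasurable hρ
  have h₂ : ∀ᵐ q ∂Q, q.2 ∈ U := by
    rw [← hsnd] at hρ
    exact ae_of_ae_map measurable_snd.aemeasurable hρ
  let D : Set (E × E) := {q | q.1 = q.2}
  have hD : MeasurableSet D := measurableSet_eq_fun measurable_fst measurable_snd
  let B : ℕ → Set (E × E) := fun k => {q | dist q.1 q.2 ≤ 1 / ((k : ℝ) + 1)}
  have hB (k : ℕ) : MeasurableSet (B k) :=
    measurableSet_le (measurable_fst.dist measurable_snd) measurable_const
  have hDB (k : ℕ) : D ⊆ B k := fun q (hq : q.1 = q.2) => by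
    simp only [B, Set.mem_ofPred_eq, hq, dist_self]
    positivity
  have hantitone : Antitone B := fun i j hij q (hq : dist q.1 q.2 ≤ _) =>
    (hq.trans (Nat.one_div_le_one_div hij) : dist q.1 q.2 ≤ _)
  have hinter : ⋂ k, (B k \ D) = ∅ := by
    ext q
    simp only [Set.mem_iInter, Set.mem_sdiff, Set.mem_empty_iff_false, iff_false, not_forall]
    by_contra! h
    refine (h 0).2 (dist_le_zero.1 (ge_of_tendsto' tendsto_one_div_add_atTop_nhds_zero_nat
      fun k => (h k).1))
  have hlim : Tendsto (fun k => Q (B k \ D)) atTop (𝓝 0) := by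
    have := tendsto_measure_iInter_atTop (μ := Q) (s := fun k => B k \ D)
      (fun k => ((hB k).diff hD).nullMeasurableSet)
      (fun i j hij => Set.sdiff_subset_sdiff_left (hantitone hij)) ⟨0, measure_ne_top _ _⟩
    rwa [hinter, measure_empty] at this
  let p : ℕ → ℕ → E × E → ℝ≥0∞ := fun k n q =>
    P {ω | dist (φ (t n) ω q.1) (φ (t n) ω q.2) ≤ 1 / ((k : ℝ) + 1)}
  have hp (k n : ℕ) : Measurable (p k n) := by
    have : MeasurableSet {r : (E × E) × Ω |
        dist (φ (t n) r.2 r.1.1) (φ (t n) r.2 r.1.2) ≤ 1 / ((k : ℝ) + 1)} :=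
      hφ.measurable_pair (t n) (hB k)
    exact measurable_measure_prodMk_left this
  have hQB (k n : ℕ) : Q (B k) = ∫⁻ q, p k n q ∂Q := by
    conv_lhs => rw [← hQ (t n), ← lintegral_indicator_one (hB k),
      hφ.lintegral_twoPoint _ _ (measurable_one.indicator (hB k))]
    refine lintegral_congr fun q => ?_
    have hmeas : MeasurableSet {ω | dist (φ (t n) ω q.1) (φ (t n) ω q.2) ≤ 1 / ((k : ℝ) + 1)} :=
      (hφ.measurable_pair (t n)).comp measurable_prodMk_left (hB k)
    exact lintegral_indicator_one (μ := P) hmeas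
  have hsplit (k n : ℕ) : ∫⁻ q in Dᶜ, p k n q ∂Q = Q (B k \ D) := by
    have h := hQB k n
    rw [← lintegral_add_compl _ hD, ← Set.sdiff_union_of_subset (hDB k),
      measure_union Set.disjoint_sdiff_left hD, add_comm] at h
    have h1 : ∫⁻ q in D, p k n q ∂Q = Q D := by
      rw [setLIntegral_congr_fun (g := fun _ => 1) hD, setLIntegral_one]
      intro q (hq : q.1 = q.2)
      have : ∀ ω, dist (φ (t n) ω q.2) (φ (t n) ω q.2) ≤ 1 / ((k : ℝ) + 1) := fun ω => by
        rw [dist_self]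
        positivity
      simp [p, hq, - one_div, - dist_self, this]
    rw [h1] at h
    exact ((ENNReal.add_right_inj (measure_ne_top Q D)).1 h).symm
  -- The infimum over `j` gives one integrand for all `k`; it stays at least `δ` on `U × U` because
  -- `δ` does not depend on `η`.
  have hle (k : ℕ) : ∫⁻ q in Dᶜ, ⨅ j, liminf (fun n => p j n q) atTop ∂Q ≤ Q (B k \ D) := by
    calc ∫⁻ q in Dᶜ, ⨅ j, liminf (fun n => p j n q) atTop ∂Q
      _ ≤ ∫⁻ q in Dᶜ, liminf (fun n => p k n q) atTop ∂Q := lintegral_mono fun q => iInf_le _ k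
      _ ≤ liminf (fun n => ∫⁻ q in Dᶜ, p k n q ∂Q) atTop := lintegral_liminf_le (hp k)
      _ = Q (B k \ D) := by simp_rw [hsplit]; simp
  have hzero : ∫⁻ q in Dᶜ, ⨅ j, liminf (fun n => p j n q) atTop ∂Q = 0 :=
    le_antisymm (ge_of_tendsto' hlim hle) zero_le
  rw [lintegral_eq_zero_iff (Measurable.iInf fun j => Measurable.liminf (hp j)),
    EventuallyEq, ae_restrict_iff' hD.compl] at hzero
  filter_upwards [hzero, h₁, h₂] with q hq hq₁ hq₂
  by_contra hne
  obtain ⟨δ, hδ0, hδ⟩ := hδ _ hq₁ _ hq₂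
  have : δ ≤ ⨅ j, liminf (fun n => p j n q) atTop :=
    le_iInf fun j => hδ (1 / ((j : ℝ) + 1)) (by positivity)
  rw [hq hne] at this
  exact hδ0.not_ge this

/-- The truncated distance as a bounded continuous function. -/
noncomputable def truncDist (E : Type*) [MetricSpace E] : E × E →ᵇ ℝ :=
  BoundedContinuousFunction.ofNormedAddCommGroup (fun q => min 1 (dist q.1 q.2)) (by fun_prop) 1
    (fun q => by
      rw [Real.norm_of_nonneg (le_min zero_le_one dist_nonneg)]
      exact min_le_left _ _)

theorem truncDist_apply {E : Type*} [MetricSpace E] (q : E × E) :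
    truncDist E q = min 1 (dist q.1 q.2) := rfl

theorem exists_integral_truncDist_lt [CompleteSpace E] (hφ : IsWhiteNoiseRDS P θ F φ)
    (hinv : IsInvariant P φ ρ) (hstab : WeakGlobalPointwiseStability P φ ρ) {ε : ℝ} (hε : 0 < ε) :
    ∃ t : ℝ≥0, ∫ q, truncDist E q ∂(twoPoint P φ t (ρ.prod ρ)) < ε := by
  obtain ⟨Q, _, hfst, hsnd, hQ, l, hl, hlim⟩ := hinv.exists_limit_twoPoint hφ
  have h0 : ∫ q, truncDist E q ∂Q = 0 := by
    refine integral_eq_zero_of_ae ?_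
    filter_upwards [hstab.ae_eq_of_twoPoint_eq hφ.toIsRDS hfst hsnd hQ] with q hq
    simp [truncDist_apply, hq]
  have h := hlim (truncDist E)
  rw [h0] at h
  obtain ⟨n, hn⟩ := (h.eventually (gt_mem_nhds hε)).exists
  exact ⟨n, hn⟩

end Limit

end RDS

/-! ### Truncated distance and convergence in probability -/

namespace RDS

/-- The truncated extended distance. -/
noncomputable def truncEDist {E : Type*} [MetricSpace E] (x y : E) : ℝ≥0∞ := min 1 (edist x y)

section TruncEDist

variable {E : Type*} [MetricSpace E]

theorem truncEDist_comm (x y : E) : truncEDist x y = truncEDist y x := by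
  rw [truncEDist, truncEDist, edist_comm]

theorem truncEDist_triangle (x y z : E) : truncEDist x z ≤ truncEDist x y + truncEDist y z := by
  unfold truncEDist
  rcases le_total 1 (edist x y) with h | h
  · rw [min_eq_left h]
    exact (min_le_left _ _).trans le_self_add
  rcases le_total 1 (edist y z) with h' | h'
  · rw [min_eq_left h']
    exact (min_le_left _ _).trans le_add_self
  rw [min_eq_right h, min_eq_right h']
  exact (min_le_right _ _).trans (edist_triangle _ _ _)

theorem ofReal_truncDist (q : E × E) : ENNReal.ofReal (truncDist E q) = truncEDist q.1 q.2 := by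
  rw [truncDist_apply, truncEDist, edist_dist, ENNReal.ofReal_min, ENNReal.ofReal_one]

theorem continuous_truncEDist : Continuous fun q : E × E => truncEDist q.1 q.2 := by
  unfold truncEDist
  fun_prop

theorem measurable_truncEDist [SecondCountableTopology E] [MeasurableSpace E] [BorelSpace E]
    {α : Type*} [MeasurableSpace α] {u v : α → E} (hu : Measurable u) (hv : Measurable v) :
    Measurable fun a => truncEDist (u a) (v a) :=
  continuous_truncEDist.measurable.comp (hu.prodMk hv)

/-- Summable terms are eventually below `1`, where truncation has no effect. -/
theorem cauchySeq_of_tsum_truncEDist_ne_top {u : ℕ → E}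
    (h : ∑' n, truncEDist (u n) (u (n + 1)) ≠ ∞) : CauchySeq u := by
  have h0 := ENNReal.tendsto_atTop_zero_of_tsum_ne_top h
  obtain ⟨N, hN⟩ := eventually_atTop.1 (h0.eventually (gt_mem_nhds one_pos))
  refine (cauchySeq_shift N).1 (cauchySeq_of_edist_le_of_tsum_ne_top
    (fun n => truncEDist (u (n + N)) (u (n + N + 1))) (fun n => ?_) ?_)
  · have hlt := hN (n + N) le_add_self
    rw [truncEDist, min_lt_iff, lt_self_iff_false, false_or] at hlt
    rw [truncEDist, min_eq_right hlt.le, Nat.succ_eq_add_one, add_right_comm]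
  · exact ne_top_of_le_ne_top h
      (ENNReal.tsum_comp_le_tsum_of_injective (add_left_injective N)
        fun n => truncEDist (u n) (u (n + 1)))

end TruncEDist

theorem tendstoInMeasure_of_tendsto_lintegral_truncEDist {Ω E ι : Type*} [MeasurableSpace Ω]
    [MetricSpace E] [SecondCountableTopology E] [MeasurableSpace E] [BorelSpace E]
    {P : Measure Ω} {X : ι → Ω → E} {a : Ω → E} {l : Filter ι}
    (hX : ∀ i, Measurable (X i)) (ha : Measurable a)
    (h : Tendsto (fun i => ∫⁻ ω, truncEDist (X i ω) (a ω) ∂P) l (𝓝 0)) :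
    TendstoInMeasure P X l a := by
  intro ε hε
  have hε' : 0 < min 1 ε := lt_min one_pos hε
  have hε'' : min 1 ε ≠ ∞ := ne_top_of_le_ne_top ENNReal.one_ne_top (min_le_left _ _)
  have hdiv : Tendsto (fun i => (∫⁻ ω, truncEDist (X i ω) (a ω) ∂P) / min 1 ε) l (𝓝 0) := by
    have := ENNReal.Tendsto.div_const h (Or.inr hε'.ne')
    rwa [ENNReal.zero_div] at this
  refine tendsto_of_tendsto_of_tendsto_of_le_of_le tendsto_const_nhds hdiv (fun i => zero_le)
    fun i => ?_
  refine le_trans (measure_mono fun ω (hω : ε ≤ _) => ?_)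
    (meas_ge_le_lintegral_div (measurable_truncEDist (hX i) ha).aemeasurable hε'.ne' hε'')
  exact min_le_min_left 1 hω

/-! ### The pullback motion -/

section PullbackMotion

variable {Ω E : Type*} [mΩ : MeasurableSpace Ω] [TopologicalSpace E] [MeasurableSpace E]
  {P : Measure Ω} {θ : ℝ → Ω → Ω} {F : ℝ → ℝ → MeasurableSpace Ω} {φ : ℝ≥0 → Ω → E → E}

/-- The pullback motion `ω ↦ φ_t(θ_{-t} ω, x)`. -/
def pullback {Ω E : Type*} (θ : ℝ → Ω → Ω) (φ : ℝ≥0 → Ω → E → E) (t : ℝ≥0) (x : E) (ω : Ω) : E :=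
  φ t (θ (-(t : ℝ)) ω) x

theorem IsRDS.measurable_pullback (hφ : IsRDS P θ φ) (t : ℝ≥0) (x : E) :
    Measurable (pullback θ φ t x) :=
  hφ.measurable_comp t (hφ.measurable_flow_apply _) measurable_const

theorem IsWhiteNoiseRDS.past_le (hφ : IsWhiteNoiseRDS P θ F φ) (t : ℝ) : past F t ≤ mΩ :=
  iSup₂_le fun s hs => hφ.sub_sigma s t hs

theorem IsWhiteNoiseRDS.measurable_pullback_past (hφ : IsWhiteNoiseRDS P θ F φ) (t : ℝ≥0)
    (x : E) : Measurable[past F 0] (pullback θ φ t x) := by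
  have h : MeasurableSpace.comap (θ (-(t : ℝ))) (F 0 t) = F (-(t : ℝ)) 0 := by
    rw [hφ.shift (-(t : ℝ)) 0 t t.2, zero_add, add_neg_cancel]
  have hle : MeasurableSpace.comap (θ (-(t : ℝ))) (F 0 t) ≤ past F 0 := by
    rw [h]
    exact le_iSup₂ (f := fun s (_ : s ≤ (0 : ℝ)) => F s 0) (-(t : ℝ)) (by simp)
  exact ((hφ.adapted t x).comp (comap_measurable (θ (-(t : ℝ))))).mono hle le_rfl

theorem IsRDS.pullback_flow (hφ : IsRDS P θ φ) (t s : ℝ≥0) (x : E) (ω : Ω) :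
    pullback θ φ (t + s) x (θ t ω) = φ t ω (pullback θ φ s x ω) := by
  have h₁ : θ (-((t + s : ℝ≥0) : ℝ)) (θ t ω) = θ (-(s : ℝ)) ω := by
    rw [← hφ.flow_add, NNReal.coe_add]
    congr 1
    ring
  have h₂ : θ s (θ (-(s : ℝ)) ω) = ω := by rw [← hφ.flow_add, add_neg_cancel, hφ.flow_zero]
  rw [pullback, hφ.cocycle_add, h₁, h₂, pullback]

end PullbackMotion

/-! ### Convergence of the pullback motion and invariance of its limit -/

section Pullback

variable {Ω E : Type*} [mΩ : MeasurableSpace Ω] [MetricSpace E] [SecondCountableTopology E]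
  [MeasurableSpace E] [BorelSpace E]
  {P : Measure Ω} [IsProbabilityMeasure P] {θ : ℝ → Ω → Ω} {F : ℝ → ℝ → MeasurableSpace Ω}
  {φ : ℝ≥0 → Ω → E → E} {ρ : Measure E} [IsProbabilityMeasure ρ]

/-- The expected truncated distance between `φ_t(·, y)` and `φ_t(·, z)`, averaged in `z`. -/
noncomputable def meanTruncDist (hφ : IsRDS P θ φ) (ρ : Measure E) [IsProbabilityMeasure ρ]
    (t : ℝ≥0) : E →ᵇ ℝ :=
  BoundedContinuousFunction.ofNormedAddCommGroup
    (fun y => ∫ z, twoPointFeller hφ t (truncDist E) (y, z) ∂ρ)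
    (continuous_of_dominated (bound := fun _ => ‖twoPointFeller hφ t (truncDist E)‖)
      (fun y => (by fun_prop : Continuous fun z =>
        twoPointFeller hφ t (truncDist E) (y, z)).measurable.aestronglyMeasurable)
      (fun y => ae_of_all _ fun z => BoundedContinuousFunction.norm_coe_le_norm _ _)
      (integrable_const _) (ae_of_all _ fun z => by fun_prop))
    ‖twoPointFeller hφ t (truncDist E)‖ (fun y => by
      refine (norm_integral_le_of_norm_le_const
        (ae_of_all _ fun z => BoundedContinuousFunction.norm_coe_le_norm _ _)).trans ?_
      simp)

theorem integral_meanTruncDist (hφ : IsRDS P θ φ) (t : ℝ≥0) :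
    ∫ y, meanTruncDist hφ ρ t y ∂ρ = ∫ q, truncDist E q ∂(twoPoint P φ t (ρ.prod ρ)) := by
  rw [hφ.integral_twoPoint,
    integral_prod _ ((twoPointFeller hφ t (truncDist E)).integrable (ρ.prod ρ))]
  rfl

theorem ofReal_twoPointFeller_truncDist (hφ : IsRDS P θ φ) (t : ℝ≥0) (y z : E) :
    ENNReal.ofReal (twoPointFeller hφ t (truncDist E) (y, z)) =
      ∫⁻ ω, truncEDist (φ t ω y) (φ t ω z) ∂P := by
  have hm : Measurable fun ω => (φ t ω y, φ t ω z) :=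
    (hφ.measurable_pair t).comp (measurable_prodMk_left (x := (y, z)))
  rw [twoPointFeller_apply, ofReal_integral_eq_lintegral_ofReal]
  · exact lintegral_congr fun ω => ofReal_truncDist _
  · exact Integrable.of_bound
      ((truncDist E).continuous.measurable.comp hm).aestronglyMeasurable ‖truncDist E‖
      (ae_of_all _ fun _ => BoundedContinuousFunction.norm_coe_le_norm _ _)
  · exact ae_of_all _ fun ω => le_min zero_le_one dist_nonneg

theorem ofReal_meanTruncDist (hφ : IsRDS P θ φ) (t : ℝ≥0) (y : E) :
    ENNReal.ofReal (meanTruncDist hφ ρ t y) =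
      ∫⁻ z, ∫⁻ ω, truncEDist (φ t ω y) (φ t ω z) ∂P ∂ρ := by
  have hc : Continuous fun z => twoPointFeller hφ t (truncDist E) (y, z) := by fun_prop
  have h0 (z : E) : 0 ≤ twoPointFeller hφ t (truncDist E) (y, z) :=
    integral_nonneg fun ω => le_min zero_le_one dist_nonneg
  have : ENNReal.ofReal (∫ z, twoPointFeller hφ t (truncDist E) (y, z) ∂ρ) =
      ∫⁻ z, ENNReal.ofReal (twoPointFeller hφ t (truncDist E) (y, z)) ∂ρ :=
    ofReal_integral_eq_lintegral_ofReal
      (Integrable.of_bound hc.measurable.aestronglyMeasurable _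
        (ae_of_all _ fun _ => BoundedContinuousFunction.norm_coe_le_norm _ _))
      (ae_of_all _ h0)
  simp_rw [ofReal_twoPointFeller_truncDist] at this
  exact this

/-- Shifting the noise by `θ_{t+s}` makes both points evolve under the last stretch of duration `t`,
from `φ_s(·, x)` and `z`; the Markov property then averages that stretch out. Strong mixing applies
to the right-hand side. -/
theorem IsWhiteNoiseRDS.lintegral_truncEDist_pullback (hφ : IsWhiteNoiseRDS P θ F φ)
    (t s : ℝ≥0) (x : E) :
    ∫⁻ z, ∫⁻ ω, truncEDist (pullback θ φ (t + s) x ω) (pullback θ φ t z ω) ∂P ∂ρ =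
      ∫⁻ ω, ENNReal.ofReal (meanTruncDist hφ.toIsRDS ρ t (φ s ω x)) ∂P := by
  have h (z : E) : ∫⁻ ω, truncEDist (pullback θ φ (t + s) x ω) (pullback θ φ t z ω) ∂P =
      ∫⁻ ω₁, ∫⁻ ω₂, truncEDist (φ t ω₂ (φ s ω₁ x)) (φ t ω₂ z) ∂P ∂P := by
    rw [← hφ.lintegral_pair_comp_flow s t (hφ.adapted s x)
      (@measurable_const _ _ _ (F 0 s) z) continuous_truncEDist.measurable,
      ← (hφ.measurePreserving (t + s : ℝ≥0)).lintegral_comp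
      (measurable_truncEDist (hφ.measurable_pullback _ x) (hφ.measurable_pullback _ z))]
    refine lintegral_congr fun ω => ?_
    simp only [pullback, ← hφ.flow_add, hφ.cocycle_add]
    simp only [NNReal.coe_add]
    rw [show (s : ℝ) + (-((t : ℝ) + s) + (t + s)) = s by ring,
      show -((t : ℝ) + s) + (t + s) = 0 by ring, show -(t : ℝ) + (t + s) = s by ring,
      hφ.flow_zero]
  simp_rw [h, ofReal_meanTruncDist]
  refine lintegral_lintegral_swap (Measurable.aemeasurable ?_)
  have hm : Measurable fun p : (E × Ω) × Ω =>
      truncEDist (φ t p.2 (φ s p.1.2 x)) (φ t p.2 p.1.1) :=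
    measurable_truncEDist
      (hφ.measurable_comp t (by fun_prop) (hφ.measurable_comp s (by fun_prop) (by fun_prop)))
      (hφ.measurable_comp t (by fun_prop) (by fun_prop))
  exact hm.lintegral_prod_right'

/-- Both pullbacks are compared with the pullback at a fixed time `r` from a `ρ`-random point `z`.
-/
theorem exists_lintegral_truncEDist_pullback_le [CompleteSpace E]
    (hφ : IsWhiteNoiseRDS P θ F φ) (hinv : IsInvariant P φ ρ) (hmix : IsStronglyMixing P φ ρ)
    (hstab : WeakGlobalPointwiseStability P φ ρ) (x y : E) {ε : ℝ≥0∞} (hε : 0 < ε) :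
    ∃ T : ℝ≥0, ∀ t ≥ T, ∀ s ≥ T,
      ∫⁻ ω, truncEDist (pullback θ φ t x ω) (pullback θ φ s y ω) ∂P ≤ ε := by
  obtain ⟨δ, hδ0, hδ⟩ : ∃ δ : ℝ, 0 < δ ∧ ENNReal.ofReal δ ≤ ε / 2 := by
    obtain ⟨δ, hδ0, hδ⟩ := ENNReal.lt_iff_exists_nnreal_btwn.1 (ENNReal.half_pos hε.ne')
    exact ⟨δ, by exact_mod_cast hδ0, by simpa using hδ.le⟩
  obtain ⟨r, hr⟩ := exists_integral_truncDist_lt hφ hinv hstab hδ0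
  rw [← integral_meanTruncDist hφ.toIsRDS] at hr
  have key (x : E) : ∀ᶠ s in atTop,
      ∫⁻ z, ∫⁻ ω, truncEDist (pullback θ φ (r + s) x ω) (pullback θ φ r z ω) ∂P ∂ρ ≤ ε / 2 := by
    filter_upwards [(hmix (meanTruncDist hφ.toIsRDS ρ r) x).eventually (gt_mem_nhds hr)]
      with s hs
    rw [hφ.lintegral_truncEDist_pullback, ← ofReal_integral_eq_lintegral_ofReal]
    · exact (ENNReal.ofReal_le_ofReal hs.le).trans hδ
    · exact Integrable.of_bound ((meanTruncDist hφ.toIsRDS ρ r).continuous.measurable.comp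
        (hφ.measurable_comp s measurable_id measurable_const)).aestronglyMeasurable _
        (ae_of_all _ fun _ => BoundedContinuousFunction.norm_coe_le_norm _ _)
    · exact ae_of_all _ fun ω => integral_nonneg fun z => integral_nonneg fun ω =>
        le_min zero_le_one dist_nonneg
  obtain ⟨T, hT⟩ := eventually_atTop.1 ((key x).and (key y))
  refine ⟨r + T, fun t ht s hs => ?_⟩
  obtain ⟨t, rfl⟩ := exists_add_of_le (le_self_add.trans ht)
  obtain ⟨s, rfl⟩ := exists_add_of_le (le_self_add.trans hs)
  have h₁ := (hT t (by simpa using ht)).1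
  have h₂ := (hT s (by simpa using hs)).2
  have hm (t : ℝ≥0) (x : E) : Measurable fun p : E × Ω =>
      truncEDist (pullback θ φ t x p.2) (pullback θ φ r p.1 p.2) :=
    measurable_truncEDist ((hφ.measurable_pullback t x).comp measurable_snd)
      (hφ.measurable_comp r ((hφ.measurable_flow_apply _).comp measurable_snd) measurable_fst)
  calc ∫⁻ ω, truncEDist (pullback θ φ (r + t) x ω) (pullback θ φ (r + s) y ω) ∂P
    _ = ∫⁻ _, ∫⁻ ω, truncEDist (pullback θ φ (r + t) x ω) (pullback θ φ (r + s) y ω) ∂P ∂ρ := by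
      simp
    _ ≤ ∫⁻ z, ∫⁻ ω, (truncEDist (pullback θ φ (r + t) x ω) (pullback θ φ r z ω) +
          truncEDist (pullback θ φ (r + s) y ω) (pullback θ φ r z ω)) ∂P ∂ρ := by
      refine lintegral_mono fun z => lintegral_mono fun ω => ?_
      rw [truncEDist_comm (pullback θ φ (r + s) y ω)]
      exact truncEDist_triangle _ _ _
    _ = ∫⁻ z, ∫⁻ ω, truncEDist (pullback θ φ (r + t) x ω) (pullback θ φ r z ω) ∂P ∂ρ +
        ∫⁻ z, ∫⁻ ω, truncEDist (pullback θ φ (r + s) y ω) (pullback θ φ r z ω) ∂P ∂ρ := by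
      rw [← lintegral_add_left (hm _ _).lintegral_prod_right']
      refine lintegral_congr fun z => ?_
      exact lintegral_add_left ((hm _ _).comp measurable_prodMk_left) _
    _ ≤ ε / 2 + ε / 2 := add_le_add h₁ h₂
    _ = ε := ENNReal.add_halves ε

theorem exists_ae_tendsto_pullback [CompleteSpace E]
    (hφ : IsWhiteNoiseRDS P θ F φ) (hinv : IsInvariant P φ ρ) (hmix : IsStronglyMixing P φ ρ)
    (hstab : WeakGlobalPointwiseStability P φ ρ) (x : E) :
    ∃ (a : Ω → E) (τ : ℕ → ℝ≥0), Measurable[past F 0] a ∧ Tendsto τ atTop atTop ∧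
      ∀ᵐ ω ∂P, Tendsto (fun n => pullback θ φ (τ n) x ω) atTop (𝓝 (a ω)) := by
  have : Nonempty E := ⟨x⟩
  have hpos (n : ℕ) : (0 : ℝ≥0∞) < 2⁻¹ ^ n := ENNReal.pow_pos (by simp) n
  choose T hT using fun n : ℕ =>
    exists_lintegral_truncEDist_pullback_le hφ hinv hmix hstab x x (hpos n)
  -- The sum makes `τ m` exceed every `T n` with `n ≤ m`; the summand `n` forces divergence.
  let τ : ℕ → ℝ≥0 := fun n => n + ∑ i ∈ Finset.range (n + 1), T i
  have hτT {n m : ℕ} (h : n ≤ m) : T n ≤ τ m :=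
    (Finset.single_le_sum (fun _ _ => zero_le) (Finset.mem_range.2 (Nat.lt_succ_of_le h))).trans
      le_add_self
  -- `limUnder` is defined everywhere, so `a` is measurable for the past itself, not merely its
  -- completion.
  refine ⟨fun ω => limUnder atTop fun n => pullback θ φ (τ n) x ω, τ, ?_, ?_, ?_⟩
  · have := @StronglyMeasurable.limUnder ℕ Ω E (past F 0) _ _ atTop _
      (fun n => pullback θ φ (τ n) x) _ _
      (fun n => (hφ.measurable_pullback_past (τ n) x).stronglyMeasurable)
    exact this.measurable
  · exact tendsto_atTop_mono (fun n => le_self_add) (tendsto_natCast_atTop_atTop (R := ℝ≥0))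
  · have hm (n : ℕ) : Measurable fun ω =>
        truncEDist (pullback θ φ (τ n) x ω) (pullback θ φ (τ (n + 1)) x ω) :=
      measurable_truncEDist (hφ.measurable_pullback _ x) (hφ.measurable_pullback _ x)
    have hsum : ∫⁻ ω, ∑' n, truncEDist (pullback θ φ (τ n) x ω)
        (pullback θ φ (τ (n + 1)) x ω) ∂P ≠ ∞ := by
      rw [lintegral_tsum fun n => (hm n).aemeasurable]
      refine ne_top_of_le_ne_top ?_ (ENNReal.tsum_le_tsum fun n =>
        hT n (τ n) (hτT le_rfl) (τ (n + 1)) (hτT n.le_succ))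
      rw [ENNReal.tsum_geometric]
      simp
    filter_upwards [ae_lt_top (Measurable.tsum hm) hsum] with ω hω
    exact (cauchySeq_of_tsum_truncEDist_ne_top hω.ne).tendsto_limUnder

theorem tendsto_lintegral_truncEDist_pullback [CompleteSpace E]
    (hφ : IsWhiteNoiseRDS P θ F φ) (hinv : IsInvariant P φ ρ) (hmix : IsStronglyMixing P φ ρ)
    (hstab : WeakGlobalPointwiseStability P φ ρ) {x : E} {a : Ω → E} {τ : ℕ → ℝ≥0}
    (hτ : Tendsto τ atTop atTop)
    (ha : ∀ᵐ ω ∂P, Tendsto (fun n => pullback θ φ (τ n) x ω) atTop (𝓝 (a ω))) (y : E) :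
    Tendsto (fun t => ∫⁻ ω, truncEDist (pullback θ φ t y ω) (a ω) ∂P) atTop (𝓝 0) := by
  rw [ENNReal.tendsto_atTop_zero]
  intro ε hε
  obtain ⟨T, hT⟩ := exists_lintegral_truncEDist_pullback_le hφ hinv hmix hstab y x hε
  refine ⟨T, fun t ht => ?_⟩
  calc ∫⁻ ω, truncEDist (pullback θ φ t y ω) (a ω) ∂P
    _ ≤ ∫⁻ ω, liminf (fun n => truncEDist (pullback θ φ t y ω) (pullback θ φ (τ n) x ω))
          atTop ∂P := by
      refine lintegral_mono_ae ?_
      filter_upwards [ha] with ω hω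
      have : Tendsto (fun n => truncEDist (pullback θ φ t y ω) (pullback θ φ (τ n) x ω)) atTop
          (𝓝 (truncEDist (pullback θ φ t y ω) (a ω))) :=
        (continuous_truncEDist.tendsto (pullback θ φ t y ω, a ω)).comp
          (tendsto_const_nhds.prodMk_nhds hω)
      exact this.liminf_eq.ge
    _ ≤ liminf (fun n => ∫⁻ ω, truncEDist (pullback θ φ t y ω) (pullback θ φ (τ n) x ω) ∂P)
          atTop := lintegral_liminf_le fun n =>
      measurable_truncEDist (hφ.measurable_pullback t y) (hφ.measurable_pullback _ x)
    _ ≤ ε := by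
      refine liminf_le_of_frequently_le' (Eventually.frequently ?_)
      filter_upwards [hτ.eventually (eventually_ge_atTop T)] with n hn
      exact hT t ht _ hn

/-- The variables `φ_t(ω, pullback_{τ n})` equal `pullback_{t + τ n}` at `θ_t ω`. The first form
tends to `φ_t(ω, a(ω))` by continuity, the second to `a(θ_t ω)` by measure preservation. The times
`t + τ n` leave the sequence `τ`, hence the need for convergence over all times. -/
theorem ae_flow_eq_of_tendstoInMeasure_pullback (hφ : IsRDS P θ φ) {x : E} {a : Ω → E}
    (ham : Measurable a) {τ : ℕ → ℝ≥0} (hτ : Tendsto τ atTop atTop)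
    (ha : ∀ᵐ ω ∂P, Tendsto (fun n => pullback θ φ (τ n) x ω) atTop (𝓝 (a ω)))
    (h : TendstoInMeasure P (fun t => pullback θ φ t x) atTop a) (t : ℝ≥0) :
    ∀ᵐ ω ∂P, φ t ω (a ω) = a (θ t ω) := by
  have h₁ : TendstoInMeasure P (fun n ω => φ t ω (pullback θ φ (τ n) x ω)) atTop
      fun ω => φ t ω (a ω) := by
    refine tendstoInMeasure_of_tendsto_ae (fun n => (hφ.measurable_comp t measurable_id
      (hφ.measurable_pullback _ x)).aestronglyMeasurable) ?_
    filter_upwards [ha] with ω hω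
    exact ((hφ.continuous_space t ω).tendsto _).comp hω
  have h₂ : TendstoInMeasure P (fun n ω => φ t ω (pullback θ φ (τ n) x ω)) atTop
      fun ω => a (θ t ω) := by
    intro ε hε
    have hτt : Tendsto (fun n => t + τ n) atTop atTop := tendsto_atTop_mono (fun n => le_add_self) hτ
    refine ((h ε hε).comp hτt).congr fun n => ?_
    have hs : MeasurableSet {ω | ε ≤ edist (pullback θ φ (t + τ n) x ω) (a ω)} :=
      measurableSet_le measurable_const ((hφ.measurable_pullback _ x).edist ham)
    simp_rw [← hφ.pullback_flow]
    exact ((hφ.measurePreserving t).measure_preimage hs.nullMeasurableSet).symm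
  exact tendstoInMeasure_ae_unique h₁ h₂

end Pullback

end RDS

theorem mainTheorem1 {Ω E : Type*} [MeasurableSpace Ω]
    [MetricSpace E] [CompleteSpace E] [TopologicalSpace.SeparableSpace E] [MeasurableSpace E] [BorelSpace E]
    (P : Measure Ω) [IsProbabilityMeasure P] (θ : ℝ → Ω → Ω)
    (F : ℝ → ℝ → MeasurableSpace Ω) (φ : ℝ≥0 → Ω → E → E)
    (hφ : RDS.IsWhiteNoiseRDS P θ F φ)
    (ρ : Measure E) [IsProbabilityMeasure ρ]
    (hinv : RDS.IsInvariant P φ ρ)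
    (hmix : RDS.IsStronglyMixing P φ ρ)
    (hstab : RDS.WeakGlobalPointwiseStability P φ ρ) :
    RDS.WeakSynchronization P θ F φ := by
  have : SecondCountableTopology E := UniformSpace.secondCountable_of_separable E
  obtain ⟨x⟩ : Nonempty E := nonempty_of_isProbabilityMeasure ρ
  obtain ⟨a, τ, ham, hτ, ha⟩ := RDS.exists_ae_tendsto_pullback hφ hinv hmix hstab x
  have ham' : Measurable a := ham.mono (hφ.past_le 0) le_rfl
  have hlim (y : E) : TendstoInMeasure P (fun t => RDS.pullback θ φ t y) atTop a :=
    RDS.tendstoInMeasure_of_tendsto_lintegral_truncEDist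
      (fun t => hφ.measurable_pullback t y) ham'
      (RDS.tendsto_lintegral_truncEDist_pullback hφ hinv hmix hstab hτ ha y)
  refine ⟨a, ham, RDS.ae_flow_eq_of_tendstoInMeasure_pullback hφ.toIsRDS ham' hτ ha (hlim x),
    fun y ε hε => (hlim y ε hε).congr fun t => ?_⟩
  simp only [RDS.pullback, edist_dist, dist_zero_right, Real.norm_of_nonneg dist_nonneg]
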